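/- Let $m,n,k$ be positive integers with $k\le\min\{m,n\}$, let $2\le p<\infty$ and $\varepsilon\in[0,1)$, and let $A,B$ be complex $m\times n$ matrices. Write $\sigma_1(X)\ge\sigma_2(X)\ge\cdots\ge\sigma_{\min\{m,n\}}(X)$ for the singular values of an $m\times n$ matrix $X$, and let $\|X\|_{(p,k)}=\big(\sum_{i=1}^{k}\sigma_i(X)^p\big)^{1/p}$ be its Ky Fan $p$-$k$ norm. Say that $A$ is $\varepsilon$-Birkhoff orthogonal to $B$ in this norm if $$\|A+\lambda B\|_{(p,k)}^2\ \ge\ \|A\|_{(p,k)}^2-2\varepsilon\,\|A\|_{(p,k)}\,\|\lambda B\|_{(p,k)}\qquad\text{for all }\lambda\in\mathbb C .$$ Then $A$ is $\varepsilon$-Birkhoff orthogonal to $B$ in the norm $\|\cdot\|_{(p,k)}$ if and only if there exist $k$ orthonormal vectors $v_1,\dots,v_k\in\mathbb C^n$ with $A^*Av_i=\sigma_i(A)^2v_i$ for all $1\le i\le k$, and a number $z_0\in\mathbb C$ with $|z_0|\le 1$, such that $$\frac{1}{\|A\|_{(p,k)}^{p-1}}\sum_{i=1}^{k}\big\langle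 (A^*A)^{\frac{p-2}{2}}A^*Bv_i,\,v_i\big\rangle+z_0\,\varepsilon\,\|B\|_{(p,k)}=0 .$$ Here $\langle\cdot,\cdot\rangle$ is the standard inner product of $\mathbb C^n$, linear in its first argument, $(A^*A)^0=I$, and for $A=0$ the first term is read as $0$. -/

import Mathlib

/-- `singularValue A i` is the `(i + 1)`-st singular value of the complex `m × n` matrix `A`: the
singular values are arranged in non-increasing order, and the index starts at `0`. -/
noncomputable def singularValue {m n : ℕ} (A : Matrix (Fin m) (Fin n) ℂ) (i : ℕ) : ℝ :=
  (Matrix.toEuclideanLin A).singularValues i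

/-- The Ky Fan `p`-`k` norm: the `ℓ_p` norm of the vector of the `k` largest singular values. -/
noncomputable def kyFanNorm (p : ℝ) (k : ℕ) {m n : ℕ} (A : Matrix (Fin m) (Fin n) ℂ) : ℝ :=
  (∑ i ∈ Finset.range k, singularValue A i ^ p) ^ (1 / p)

/-- `A` is `ε`-Birkhoff orthogonal to `B` with respect to the norm `N`. -/
def EpsBirkhoffOrthogonal {E : Type*} [AddCommGroup E] [Module ℂ E] (N : E → ℝ) (ε : ℝ)
    (A B : E) : Prop :=
  ∀ z : ℂ, N A ^ 2 - 2 * ε * N A * N (z • B) ≤ N (A + z • B) ^ 2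

/-- The power `(A* A) ^ s` of the positive semidefinite matrix `A* A`, in the sense of the
functional calculus (so that it is the identity matrix for `s = 0`). -/
noncomputable def gramPow {m n : ℕ} (A : Matrix (Fin m) (Fin n) ℂ) (s : ℝ) :
    Matrix (Fin n) (Fin n) ℂ :=
  cfc (fun x : ℝ => x ^ s) (A.conjTranspose * A)

/-!
Write `N` for the Ky Fan norm, and call right singular vectors `v` of `T` for the `k` largest
singular values a top frame of `T`. By Ky Fan's majorization and Hölder's inequality, the functional
`φ_v S = ∑ ⟨(T* T) ^ ((p - 2) / 2) T* S v i, v i⟩` satisfies `‖φ_v S‖ ≤ N T ^ (p - 1) * N S` and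
`φ_v T = N T ^ p`. The criterion therefore asks for a top frame with
`‖φ_v S‖ ≤ ε * N T ^ (p - 1) * N S`, and such a frame gives `N T - ε * N (z • S) ≤ N (T + z • S)`,
which is stronger than orthogonality.

Conversely, apply the support inequality at `T + t • S` and let `t → 0⁺`: by compactness, top frames
of `T + t • S` accumulate at a top frame of `T`, and orthogonality becomes a lower bound for
`re (φ_v S)`. Rotating `S` yields such a bound in every direction of `ℂ`, so if the values `φ_v S`
form a compact convex set, separating it from the origin yields one of modulus at most
`ε * N T ^ (p - 1) * N S`.

For convexity, two top frames of `T` span the same space outside the eigenspace of `T* T` for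
`σ_k ^ 2`. If `k'` members of a top frame lie in this eigenspace, then only their partial trace
varies, and its values form the `k'`-numerical range of a compression. That range is convex because
it is the linear image of the operators `0 ≤ X ≤ 1` of trace `k'`: an extreme point of a fibre is a
projection, since an operator with two fractional eigenvalues can be perturbed along the
three-dimensional space of trace-zero self-adjoint operators on the two eigenvectors, within the
fibre, which has real codimension two.
-/

theorem sq_rpow_div_two {x : ℝ} (hx : 0 ≤ x) (p : ℝ) : (x ^ 2) ^ (p / 2) = x ^ p := by
  rw [← Real.rpow_natCast_mul hx, Nat.cast_ofNat, mul_div_cancel₀ p two_ne_zero]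

section TopFrame

open Module

variable {𝕜 E F : Type*} [RCLike 𝕜]
  [NormedAddCommGroup E] [InnerProductSpace 𝕜 E] [FiniteDimensional 𝕜 E]
  [NormedAddCommGroup F] [InnerProductSpace 𝕜 F] [FiniteDimensional 𝕜 F]

/-- `v` is a family of orthonormal right singular vectors of `T` for its `k` largest singular
values, listed in order. -/
def IsTopFrame (T : E →ₗ[𝕜] F) {k : ℕ} (v : Fin k → E) : Prop :=
  Orthonormal 𝕜 v ∧
    ∀ i : Fin k, LinearMap.adjoint T (T (v i)) = ((T.singularValues i ^ 2 : ℝ) : 𝕜) • v i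

theorem exists_orthonormalBasis_isTopFrame (T : E →ₗ[𝕜] F) :
    ∃ u : OrthonormalBasis (Fin (finrank 𝕜 E)) 𝕜 E, IsTopFrame T u := by
  refine ⟨T.isSymmetric_adjoint_comp_self.eigenvectorBasis rfl, OrthonormalBasis.orthonormal _,
    fun j => ?_⟩
  rw [T.sq_singularValues_fin rfl j]
  exact T.isSymmetric_adjoint_comp_self.apply_eigenvectorBasis rfl j

namespace IsTopFrame

variable {T : E →ₗ[𝕜] F} {k : ℕ} {v : Fin k → E}

theorem comp_castLE (hv : IsTopFrame T v) {l : ℕ} (hl : l ≤ k) :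
    IsTopFrame T (v ∘ Fin.castLE hl) :=
  ⟨hv.1.comp _ (Fin.castLE_injective hl), fun i => hv.2 (Fin.castLE hl i)⟩

theorem inner_apply_apply (hv : IsTopFrame T v) (i : Fin k) (x : E) :
    inner 𝕜 (T (v i)) (T x) = ((T.singularValues i ^ 2 : ℝ) : 𝕜) * inner 𝕜 (v i) x := by
  rw [← LinearMap.adjoint_inner_left, hv.2 i, inner_smul_left, RCLike.conj_ofReal]

theorem norm_apply (hv : IsTopFrame T v) (i : Fin k) : ‖T (v i)‖ = T.singularValues i := by
  have h := hv.inner_apply_apply i (v i)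
  rw [inner_self_eq_norm_sq_to_K, inner_self_eq_norm_sq_to_K, hv.1.1 i, RCLike.ofReal_one,
    one_pow, mul_one] at h
  exact (sq_eq_sq₀ (norm_nonneg _) (T.singularValues_nonneg i)).1 (by exact_mod_cast h)

theorem le_finrank (hv : IsTopFrame T v) : k ≤ finrank 𝕜 E := by
  simpa using hv.1.linearIndependent.fintype_card_le_finrank

end IsTopFrame

theorem exists_isTopFrame (T : E →ₗ[𝕜] F) {k : ℕ} (hk : k ≤ finrank 𝕜 E) :
    ∃ v : Fin k → E, IsTopFrame T v :=
  (exists_orthonormalBasis_isTopFrame T).elim fun _ hu => ⟨_, hu.comp_castLE hk⟩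

theorem norm_sq_apply_eq_sum {T : E →ₗ[𝕜] F} {u : OrthonormalBasis (Fin (finrank 𝕜 E)) 𝕜 E}
    (hu : IsTopFrame T u) (x : E) :
    ‖T x‖ ^ 2 = ∑ j, ‖inner 𝕜 (u j) x‖ ^ 2 * T.singularValues j ^ 2 := by
  have h : inner 𝕜 (T x) (T x) =
      ((∑ j, ‖inner 𝕜 (u j) x‖ ^ 2 * T.singularValues j ^ 2 : ℝ) : 𝕜) := by
    have expansion : T x = ∑ j, inner 𝕜 (u j) x • T (u j) := by
      simp only [← map_smul, ← map_sum, u.sum_repr']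
    nth_rw 1 [expansion]
    simp only [sum_inner, inner_smul_left, hu.inner_apply_apply, RCLike.ofReal_sum,
      RCLike.ofReal_mul, RCLike.ofReal_pow, ← RCLike.conj_mul]
    exact Finset.sum_congr rfl fun j _ => by ring
  rw [inner_self_eq_norm_sq_to_K] at h
  exact_mod_cast h

theorem sum_mul_le_sum_range_of_antitone {k n : ℕ} (hkn : k ≤ n) {μ : ℕ → ℝ} (hμ : Antitone μ)
    {s : Fin n → ℝ} (hs0 : ∀ j, 0 ≤ s j) (hs1 : ∀ j, s j ≤ 1) (hs : ∑ j, s j = k) :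
    ∑ j : Fin n, s j * μ j ≤ ∑ j ∈ Finset.range k, μ j := by
  have shifted : ∑ j : Fin n, s j * (μ j - μ k) ≤ ∑ j ∈ Finset.range k, (μ j - μ k) := by
    calc ∑ j : Fin n, s j * (μ j - μ k)
        ≤ ∑ j : Fin n, if (j : ℕ) < k then μ j - μ k else 0 := by
          refine Finset.sum_le_sum fun j _ => ?_
          split_ifs with h
          · exact mul_le_of_le_one_left (sub_nonneg.2 (hμ h.le)) (hs1 j)
          · exact mul_nonpos_of_nonneg_of_nonpos (hs0 j) (sub_nonpos.2 (hμ (not_lt.1 h)))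
      _ = ∑ j ∈ Finset.range k, (μ j - μ k) := by
          rw [Fin.sum_univ_eq_sum_range (fun j => if j < k then μ j - μ k else 0),
            ← Finset.sum_filter]
          congr 1
          ext j
          simp only [Finset.mem_filter, Finset.mem_range]
          omega
  simp only [mul_sub, Finset.sum_sub_distrib, ← Finset.sum_mul, hs, Finset.sum_const,
    Finset.card_range, nsmul_eq_mul] at shifted
  linarith

theorem sum_norm_rpow_le_sum_singularValues_rpow (T : E →ₗ[𝕜] F) {p : ℝ} (hp : 2 ≤ p) {k : ℕ}
    {v : Fin k → E} (hv : Orthonormal 𝕜 v) :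
    ∑ i, ‖T (v i)‖ ^ p ≤ ∑ j ∈ Finset.range k, T.singularValues j ^ p := by
  obtain ⟨u, hu⟩ := exists_orthonormalBasis_isTopFrame T
  let w (i : Fin k) (j : Fin (finrank 𝕜 E)) : ℝ := ‖inner 𝕜 (u j) (v i)‖ ^ 2
  have hw_row (i : Fin k) : ∑ j, w i j = 1 := by
    simp only [w, u.sum_sq_norm_inner_right, hv.1 i, one_pow]
  have hw_col (j) : ∑ i, w i j ≤ 1 := by
    have := hv.sum_inner_products_le (s := Finset.univ) (u j)
    rw [u.orthonormal.1 j, one_pow] at this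
    simpa only [w, norm_inner_symm] using this
  have jensen (i : Fin k) : ‖T (v i)‖ ^ p ≤ ∑ j, w i j * T.singularValues j ^ p := by
    have := Real.rpow_arith_mean_le_arith_mean_rpow Finset.univ (w i)
      (fun j => T.singularValues j ^ 2) (fun _ _ => by positivity) (hw_row i)
      (fun _ _ => by positivity) (p := p / 2) (by linarith)
    simpa only [w, ← norm_sq_apply_eq_sum hu, sq_rpow_div_two (norm_nonneg _),
      sq_rpow_div_two (T.singularValues_nonneg _)] using this
  calc ∑ i, ‖T (v i)‖ ^ p ≤ ∑ i, ∑ j, w i j * T.singularValues j ^ p :=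
        Finset.sum_le_sum fun i _ => jensen i
    _ = ∑ j, (∑ i, w i j) * T.singularValues j ^ p := by
        rw [Finset.sum_comm]
        simp only [Finset.sum_mul]
    _ ≤ ∑ j ∈ Finset.range k, T.singularValues j ^ p := by
        refine sum_mul_le_sum_range_of_antitone (μ := fun j => T.singularValues j ^ p)
          (by simpa using hv.linearIndependent.fintype_card_le_finrank)
          (fun i j hij => Real.rpow_le_rpow (T.singularValues_nonneg j)
            (T.singularValues_antitone hij) (by linarith))
          (fun j => Finset.sum_nonneg fun i _ => by positivity) hw_col ?_
        rw [Finset.sum_comm]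
        simp [hw_row]

/-- The Ky Fan `p`-`k` norm of an operator, `(∑ σ_i ^ p) ^ (1 / p)` over its `k` largest singular
values; it is a norm when `1 ≤ p` and `1 ≤ k ≤ dim E`. -/
noncomputable def operatorKyFanNorm (p : ℝ) (k : ℕ) (T : E →ₗ[𝕜] F) : ℝ :=
  (∑ i ∈ Finset.range k, T.singularValues i ^ p) ^ (1 / p)

variable {p : ℝ} {k : ℕ}

theorem sum_singularValues_rpow_nonneg (p : ℝ) (k : ℕ) (T : E →ₗ[𝕜] F) :
    0 ≤ ∑ i ∈ Finset.range k, T.singularValues i ^ p :=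
  Finset.sum_nonneg fun i _ => Real.rpow_nonneg (T.singularValues_nonneg i) p

theorem operatorKyFanNorm_nonneg (p : ℝ) (k : ℕ) (T : E →ₗ[𝕜] F) : 0 ≤ operatorKyFanNorm p k T :=
  Real.rpow_nonneg (sum_singularValues_rpow_nonneg p k T) _

theorem operatorKyFanNorm_rpow (hp : p ≠ 0) (k : ℕ) (T : E →ₗ[𝕜] F) :
    operatorKyFanNorm p k T ^ p = ∑ i ∈ Finset.range k, T.singularValues i ^ p := by
  rw [operatorKyFanNorm, one_div, Real.rpow_inv_rpow (sum_singularValues_rpow_nonneg p k T) hp]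

theorem Lp_norm_apply_le_operatorKyFanNorm (hp : 2 ≤ p) {v : Fin k → E} (hv : Orthonormal 𝕜 v)
    (T : E →ₗ[𝕜] F) : (∑ i, ‖T (v i)‖ ^ p) ^ (1 / p) ≤ operatorKyFanNorm p k T :=
  Real.rpow_le_rpow (Finset.sum_nonneg fun i _ => Real.rpow_nonneg (norm_nonneg _) p)
    (sum_norm_rpow_le_sum_singularValues_rpow T hp hv) (by positivity)

theorem IsTopFrame.Lp_norm_apply {T : E →ₗ[𝕜] F} {v : Fin k → E} (hv : IsTopFrame T v) (p : ℝ) :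
    (∑ i, ‖T (v i)‖ ^ p) ^ (1 / p) = operatorKyFanNorm p k T := by
  simp only [operatorKyFanNorm, hv.norm_apply,
    Fin.sum_univ_eq_sum_range (fun i => T.singularValues i ^ p)]

theorem operatorKyFanNorm_add_le (hp : 2 ≤ p) (hk : k ≤ finrank 𝕜 E) (T S : E →ₗ[𝕜] F) :
    operatorKyFanNorm p k (T + S) ≤ operatorKyFanNorm p k T + operatorKyFanNorm p k S := by
  obtain ⟨v, hv⟩ := exists_isTopFrame (T + S) hk
  calc operatorKyFanNorm p k (T + S) = (∑ i, ‖T (v i) + S (v i)‖ ^ p) ^ (1 / p) :=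
        (hv.Lp_norm_apply p).symm
    _ ≤ (∑ i, (‖T (v i)‖ + ‖S (v i)‖) ^ p) ^ (1 / p) := by
        gcongr with i
        exact norm_add_le _ _
    _ ≤ (∑ i, ‖T (v i)‖ ^ p) ^ (1 / p) + (∑ i, ‖S (v i)‖ ^ p) ^ (1 / p) :=
        Real.Lp_add_le_of_nonneg Finset.univ (by linarith) (fun i _ => norm_nonneg _)
          fun i _ => norm_nonneg _
    _ ≤ operatorKyFanNorm p k T + operatorKyFanNorm p k S :=
        add_le_add (Lp_norm_apply_le_operatorKyFanNorm hp hv.1 T)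
          (Lp_norm_apply_le_operatorKyFanNorm hp hv.1 S)

theorem operatorKyFanNorm_smul_le (hp : 2 ≤ p) (hk : k ≤ finrank 𝕜 E) (c : 𝕜) (T : E →ₗ[𝕜] F) :
    operatorKyFanNorm p k (c • T) ≤ ‖c‖ * operatorKyFanNorm p k T := by
  obtain ⟨v, hv⟩ := exists_isTopFrame (c • T) hk
  calc operatorKyFanNorm p k (c • T) = (∑ i, ‖(c • T) (v i)‖ ^ p) ^ (1 / p) :=
        (hv.Lp_norm_apply p).symm
    _ = ‖c‖ * (∑ i, ‖T (v i)‖ ^ p) ^ (1 / p) := by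
        simp only [LinearMap.smul_apply, norm_smul, Real.mul_rpow (norm_nonneg _) (norm_nonneg _),
          ← Finset.mul_sum]
        rw [Real.mul_rpow (by positivity) (by positivity), one_div,
          Real.rpow_rpow_inv (norm_nonneg c) (by linarith)]
    _ ≤ ‖c‖ * operatorKyFanNorm p k T :=
        mul_le_mul_of_nonneg_left (Lp_norm_apply_le_operatorKyFanNorm hp hv.1 T) (norm_nonneg c)

/-- The Ky Fan norm as a seminorm, which gives access to the continuity of seminorms on
finite-dimensional spaces. -/
noncomputable def kyFanSeminorm (hp : 2 ≤ p) (hk : k ≤ finrank 𝕜 E) : Seminorm 𝕜 (E →ₗ[𝕜] F) :=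
  Seminorm.ofSMulLE (operatorKyFanNorm p k)
    (by
      have hp0 : p ≠ 0 := by linarith
      simp [operatorKyFanNorm, hp0])
    (operatorKyFanNorm_add_le hp hk) (operatorKyFanNorm_smul_le hp hk)

theorem continuous_operatorKyFanNorm (hp : 2 ≤ p) (hk : k ≤ finrank 𝕜 E) :
    Continuous fun T : E →L[𝕜] F => operatorKyFanNorm p k (T : E →ₗ[𝕜] F) := by
  let _ : NormedSpace ℝ (E →L[𝕜] F) := NormedSpace.restrictScalars ℝ 𝕜 _
  have _ : FiniteDimensional ℝ (E →L[𝕜] F) := FiniteDimensional.trans ℝ 𝕜 _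
  let q : Seminorm 𝕜 (E →L[𝕜] F) :=
    (kyFanSeminorm hp hk).comp (ContinuousLinearMap.coeLM 𝕜 : (E →L[𝕜] F) →ₗ[𝕜] E →ₗ[𝕜] F)
  exact q.convexOn.locallyLipschitz.continuous

theorem operatorKyFanNorm_two_succ_sq (T : E →ₗ[𝕜] F) (i : ℕ) :
    operatorKyFanNorm 2 (i + 1) T ^ 2 =
      operatorKyFanNorm 2 i T ^ 2 + T.singularValues i ^ 2 := by
  simp only [← Real.rpow_two, operatorKyFanNorm_rpow two_ne_zero, Finset.sum_range_succ]

theorem continuous_singularValues (i : ℕ) :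
    Continuous fun T : E →L[𝕜] F => (T : E →ₗ[𝕜] F).singularValues i := by
  rcases le_or_gt (finrank 𝕜 E) i with hi | hi
  · simp only [LinearMap.singularValues_of_finrank_le _ hi, continuous_const]
  have h (T : E →L[𝕜] F) : (T : E →ₗ[𝕜] F).singularValues i =
      √(operatorKyFanNorm 2 (i + 1) (T : E →ₗ[𝕜] F) ^ 2 -
        operatorKyFanNorm 2 i (T : E →ₗ[𝕜] F) ^ 2) := by
    rw [operatorKyFanNorm_two_succ_sq, add_sub_cancel_left,
      Real.sqrt_sq (LinearMap.singularValues_nonneg _ i)]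
  simp only [h]
  exact (((continuous_operatorKyFanNorm le_rfl hi).pow 2).sub
    ((continuous_operatorKyFanNorm le_rfl hi.le).pow 2)).sqrt

/-- The functional `S ↦ ∑ i, ⟨(T* T) ^ ((p - 2) / 2) T* S v i, v i⟩` in terms of a top frame `v`
of `T`. Divided by `‖T‖ ^ (p - 1)`, it supports the unit ball of the Ky Fan norm at `T / ‖T‖`. -/
noncomputable def kyFanSupport (p : ℝ) (T : E →ₗ[𝕜] F) (v : Fin k → E) :
    (E →ₗ[𝕜] F) →ₗ[𝕜] 𝕜 where
  toFun S := ∑ i : Fin k, ((T.singularValues i ^ (p - 2) : ℝ) : 𝕜) * inner 𝕜 (T (v i)) (S (v i))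
  map_add' S S' := by
    simp only [LinearMap.add_apply, inner_add_right, mul_add, Finset.sum_add_distrib]
  map_smul' c S := by
    simp only [LinearMap.smul_apply, inner_smul_right, mul_left_comm _ c, Finset.mul_sum,
      RingHom.id_apply, smul_eq_mul]

theorem kyFanSupport_apply (p : ℝ) (T : E →ₗ[𝕜] F) (v : Fin k → E) (S : E →ₗ[𝕜] F) :
    kyFanSupport p T v S =
      ∑ i : Fin k, ((T.singularValues i ^ (p - 2) : ℝ) : 𝕜) * inner 𝕜 (T (v i)) (S (v i)) :=
  rfl

theorem rpow_sub_two_mul_sq {x : ℝ} (hx : 0 ≤ x) (hp : p ≠ 0) : x ^ (p - 2) * x ^ 2 = x ^ p := by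
  rw [← Real.rpow_natCast, ← Real.rpow_add' hx (by simpa), Nat.cast_ofNat, sub_add_cancel]

theorem rpow_sub_two_mul {x : ℝ} (hx : 0 ≤ x) (hp : p ≠ 1) : x ^ (p - 2) * x = x ^ (p - 1) := by
  rw [← Real.rpow_add_one' hx (by contrapose! hp; linarith)]
  ring_nf

namespace IsTopFrame

variable {T : E →ₗ[𝕜] F} {v : Fin k → E}

theorem kyFanSupport_self (hv : IsTopFrame T v) (hp : p ≠ 0) :
    kyFanSupport p T v T = ((operatorKyFanNorm p k T ^ p : ℝ) : 𝕜) := by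
  rw [operatorKyFanNorm_rpow hp, kyFanSupport_apply,
    ← Fin.sum_univ_eq_sum_range (fun i => T.singularValues i ^ p), RCLike.ofReal_sum]
  refine Finset.sum_congr rfl fun i _ => ?_
  rw [inner_self_eq_norm_sq_to_K, hv.norm_apply, ← RCLike.ofReal_pow, ← RCLike.ofReal_mul,
    rpow_sub_two_mul_sq (T.singularValues_nonneg i) hp]

theorem norm_kyFanSupport_le (hv : IsTopFrame T v) (hp : 2 ≤ p) (S : E →ₗ[𝕜] F) :
    ‖kyFanSupport p T v S‖ ≤ operatorKyFanNorm p k T ^ (p - 1) * operatorKyFanNorm p k S := by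
  have hp' : p - 1 ≠ 0 := by linarith
  have hconj := (Real.HolderConjugate.conjExponent (p := p) (by linarith)).symm
  calc ‖kyFanSupport p T v S‖
      ≤ ∑ i : Fin k, T.singularValues i ^ (p - 1) * ‖S (v i)‖ := by
        rw [kyFanSupport_apply]
        refine norm_sum_le_of_le _ fun i _ => ?_
        rw [norm_mul, RCLike.norm_ofReal,
          abs_of_nonneg (Real.rpow_nonneg (T.singularValues_nonneg i) _),
          ← rpow_sub_two_mul (T.singularValues_nonneg i) (by linarith), mul_assoc,
          ← hv.norm_apply i]
        gcongr
        exact norm_inner_le_norm _ _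
    _ ≤ (∑ i : Fin k, (T.singularValues i ^ (p - 1)) ^ (p / (p - 1))) ^ (1 / (p / (p - 1))) *
          (∑ i, ‖S (v i)‖ ^ p) ^ (1 / p) :=
        Real.inner_le_Lp_mul_Lq_of_nonneg Finset.univ hconj
          (fun i _ => Real.rpow_nonneg (T.singularValues_nonneg i) _) fun i _ => norm_nonneg _
    _ = operatorKyFanNorm p k T ^ (p - 1) * (∑ i, ‖S (v i)‖ ^ p) ^ (1 / p) := by
        simp only [← Real.rpow_mul (T.singularValues_nonneg _), mul_div_cancel₀ p hp',
          Fin.sum_univ_eq_sum_range (fun i => T.singularValues i ^ p), operatorKyFanNorm]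
        rw [← Real.rpow_mul (sum_singularValues_rpow_nonneg p k T), one_div_div,
          div_mul_eq_mul_div, one_mul]
    _ ≤ operatorKyFanNorm p k T ^ (p - 1) * operatorKyFanNorm p k S :=
        mul_le_mul_of_nonneg_left (Lp_norm_apply_le_operatorKyFanNorm hp hv.1 S)
          (Real.rpow_nonneg (operatorKyFanNorm_nonneg p k T) _)

end IsTopFrame

theorem operatorKyFanNorm_smul (hp : 2 ≤ p) (hk : k ≤ finrank 𝕜 E) (c : 𝕜) (T : E →ₗ[𝕜] F) :
    operatorKyFanNorm p k (c • T) = ‖c‖ * operatorKyFanNorm p k T :=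
  map_smul_eq_mul (kyFanSeminorm hp hk) c T

theorem isCompact_setOf_orthonormal (ι : Type*) [Finite ι] :
    IsCompact {v : ι → E | Orthonormal 𝕜 v} := by
  classical
  have := Fintype.ofFinite ι
  have : ProperSpace E := FiniteDimensional.proper_rclike 𝕜 E
  refine Metric.isCompact_of_isClosed_isBounded ?_ (Metric.isBounded_closedBall.subset
    fun v hv => mem_closedBall_zero_iff.2 ((pi_norm_le_iff_of_nonneg zero_le_one).2
      fun i => (hv.1 i).le))
  simp only [orthonormal_iff_ite, Set.ofPred_forall]
  exact isClosed_iInter fun i => isClosed_iInter fun j => isClosed_eq (by fun_prop) (by fun_prop)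

theorem isClosed_setOf_isTopFrame :
    IsClosed {x : (E →L[𝕜] F) × (Fin k → E) | IsTopFrame (x.1 : E →ₗ[𝕜] F) x.2} := by
  have := FiniteDimensional.complete 𝕜 E
  have := FiniteDimensional.complete 𝕜 F
  simp only [IsTopFrame, Set.ofPred_and, Set.ofPred_forall, LinearMap.adjoint_eq_toCLM_adjoint]
  refine ((isCompact_setOf_orthonormal (Fin k)).isClosed.preimage continuous_snd).inter
    (isClosed_iInter fun i => isClosed_eq ?_ ?_)
  · change Continuous fun x : (E →L[𝕜] F) × (Fin k → E) =>
      ContinuousLinearMap.adjoint x.1 (x.1 (x.2 i))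
    have := (ContinuousLinearMap.adjoint (𝕜 := 𝕜) (E := E) (F := F)).continuous
    fun_prop
  · exact (RCLike.continuous_ofReal.comp
      (((continuous_singularValues (i : ℕ)).comp continuous_fst).pow 2)).smul (by fun_prop)

theorem continuous_kyFanSupport (hp : 2 ≤ p) (S : E →ₗ[𝕜] F) :
    Continuous fun x : (E →L[𝕜] F) × (Fin k → E) =>
      kyFanSupport p (x.1 : E →ₗ[𝕜] F) x.2 S := by
  have hS : Continuous S := S.continuous_of_finiteDimensional
  simp only [kyFanSupport_apply, ContinuousLinearMap.coe_coe]
  refine continuous_finsetSum _ fun i _ => (RCLike.continuous_ofReal.comp ?_).mul ?_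
  · exact ((continuous_singularValues (i : ℕ)).comp continuous_fst).rpow_const
      fun _ => Or.inr (by linarith)
  · fun_prop

theorem isClosed_setOf_exists_isTopFrame {Q : Set ((E →L[𝕜] F) × (Fin k → E))}
    (hQ : IsClosed Q) :
    IsClosed {T : E →L[𝕜] F | ∃ v : Fin k → E, IsTopFrame (T : E →ₗ[𝕜] F) v ∧ (T, v) ∈ Q} := by
  have : CompactSpace {v : Fin k → E | Orthonormal 𝕜 v} :=
    isCompact_iff_compactSpace.1 (isCompact_setOf_orthonormal (Fin k))
  have closed_frames : IsClosed {x : (E →L[𝕜] F) × {v : Fin k → E | Orthonormal 𝕜 v} |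
      IsTopFrame (x.1 : E →ₗ[𝕜] F) (x.2 : Fin k → E) ∧ (x.1, (x.2 : Fin k → E)) ∈ Q} :=
    (isClosed_setOf_isTopFrame.inter hQ).preimage
      (continuous_fst.prodMk (continuous_subtype_val.comp continuous_snd))
  convert isClosedMap_fst_of_compactSpace _ closed_frames using 1
  ext T
  constructor
  · rintro ⟨v, hv, hQv⟩
    exact ⟨(T, ⟨v, hv.1⟩), ⟨hv, hQv⟩, rfl⟩
  · rintro ⟨⟨_, v⟩, ⟨hv, hQv⟩, rfl⟩
    exact ⟨v, hv, hQv⟩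

/-- The inequality is left undivided so that both sides are continuous in the perturbed operator,
even where norms vanish, and it survives the limit `t → 0⁺`. -/
theorem IsTopFrame.re_kyFanSupport_perturbation_ge {T S : E →ₗ[𝕜] F} {v : Fin k → E} {t ε : ℝ}
    (hv : IsTopFrame (T + (t : 𝕜) • S) v) (hp : 2 ≤ p) (ht : 0 < t)
    (hTS : operatorKyFanNorm p k T ^ 2 -
        2 * ε * operatorKyFanNorm p k T * (t * operatorKyFanNorm p k S) ≤
      operatorKyFanNorm p k (T + (t : 𝕜) • S) ^ 2) :
    -(2 * ε * operatorKyFanNorm p k T * operatorKyFanNorm p k S *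
        operatorKyFanNorm p k (T + (t : 𝕜) • S) ^ (p - 1)) ≤
      (operatorKyFanNorm p k (T + (t : 𝕜) • S) + operatorKyFanNorm p k T) *
        RCLike.re (kyFanSupport p (T + (t : 𝕜) • S) v S) := by
  set R := T + (t : 𝕜) • S with hR
  set N := operatorKyFanNorm (𝕜 := 𝕜) (E := E) (F := F) p k
  have hNR : 0 ≤ N R := operatorKyFanNorm_nonneg p k R
  have hNT : 0 ≤ N T := operatorKyFanNorm_nonneg p k T
  have hpow : N R ^ (p - 1) * N R = N R ^ p := by
    rw [← Real.rpow_add_one' hNR (by linarith), sub_add_cancel]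
  have increment : N R ^ (p - 1) * (N R - N T) ≤ t * RCLike.re (kyFanSupport p R v S) := by
    have hself := congrArg RCLike.re (hv.kyFanSupport_self (p := p) (by linarith))
    have hbound := (RCLike.re_le_norm _).trans (hv.norm_kyFanSupport_le hp T)
    nth_rw 2 [hR] at hself
    rw [map_add, map_smul, map_add, smul_eq_mul, RCLike.re_ofReal_mul, RCLike.ofReal_re] at hself
    linarith
  refine le_of_mul_le_mul_left ?_ ht
  nlinarith [mul_le_mul_of_nonneg_left increment (add_nonneg hNR hNT),
    mul_le_mul_of_nonneg_left hTS (Real.rpow_nonneg hNR (p - 1))]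

theorem exists_isTopFrame_mem_of_forall_pos (T S : E →ₗ[𝕜] F)
    {Q : Set ((E →L[𝕜] F) × (Fin k → E))} (hQ : IsClosed Q)
    (h : ∀ t : ℝ, 0 < t → ∃ v, IsTopFrame (T + (t : 𝕜) • S) v ∧
      (T.toContinuousLinearMap + (t : 𝕜) • S.toContinuousLinearMap, v) ∈ Q) :
    ∃ v, IsTopFrame T v ∧ (T.toContinuousLinearMap, v) ∈ Q := by
  let line (t : ℝ) : E →L[𝕜] F :=
    T.toContinuousLinearMap + (t : 𝕜) • S.toContinuousLinearMap
  have hline : Continuous line := by fun_prop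
  have h_pos : Set.Ioi (0 : ℝ) ⊆ line ⁻¹' {R | ∃ v : Fin k → E,
      IsTopFrame (R : E →ₗ[𝕜] F) v ∧ (R, v) ∈ Q} := h
  have h_zero := closure_minimal h_pos
    ((isClosed_setOf_exists_isTopFrame hQ).preimage hline)
    (show (0 : ℝ) ∈ closure (Set.Ioi 0) by simp)
  simpa [line] using h_zero

theorem exists_isTopFrame_re_kyFanSupport_ge {ε : ℝ} (hp : 2 ≤ p) (hk : k ≤ finrank 𝕜 E)
    (T S : E →ₗ[𝕜] F)
    (hTS : ∀ t : ℝ, 0 < t → operatorKyFanNorm p k T ^ 2 -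
        2 * ε * operatorKyFanNorm p k T * (t * operatorKyFanNorm p k S) ≤
      operatorKyFanNorm p k (T + (t : 𝕜) • S) ^ 2) :
    ∃ v : Fin k → E, IsTopFrame T v ∧
      -(ε * operatorKyFanNorm p k T ^ (p - 1) * operatorKyFanNorm p k S) ≤
        RCLike.re (kyFanSupport p T v S) := by
  set N := operatorKyFanNorm (𝕜 := 𝕜) (E := E) (F := F) p k with hN
  let Q : Set ((E →L[𝕜] F) × (Fin k → E)) := {x | -(2 * ε * N T * N S * N x.1 ^ (p - 1)) ≤
    (N x.1 + N T) * RCLike.re (kyFanSupport p (x.1 : E →ₗ[𝕜] F) x.2 S)}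
  have hNcont : Continuous fun x : (E →L[𝕜] F) × (Fin k → E) => N x.1 :=
    (continuous_operatorKyFanNorm hp hk).comp continuous_fst
  have hQ : IsClosed Q := by
    refine isClosed_le ?_ ?_
    · exact ((hNcont.rpow_const fun _ => Or.inr (by linarith)).const_mul _).neg
    · exact (hNcont.add continuous_const).mul
        (RCLike.continuous_re.comp (continuous_kyFanSupport hp S))
  obtain ⟨v, hv, hvQ⟩ := exists_isTopFrame_mem_of_forall_pos T S hQ fun t ht => by
    obtain ⟨v, hv⟩ := exists_isTopFrame (T + (t : 𝕜) • S) hk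
    exact ⟨v, hv, hv.re_kyFanSupport_perturbation_ge hp ht (hTS t ht)⟩
  refine ⟨v, hv, ?_⟩
  replace hvQ : -(2 * ε * N T * N S * N T ^ (p - 1)) ≤
    (N T + N T) * RCLike.re (kyFanSupport p T v S) := hvQ
  rcases (operatorKyFanNorm_nonneg p k T).eq_or_lt with hT | hT
  · have hbound := hv.norm_kyFanSupport_le hp S
    rw [← hT, Real.zero_rpow (by linarith), zero_mul, norm_le_zero_iff] at hbound
    simp [hbound, hN, ← hT, Real.zero_rpow (show p - 1 ≠ 0 by linarith)]
  · refine le_of_mul_le_mul_left ?_ (add_pos hT hT)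
    linarith

end TopFrame

theorem epsBirkhoffOrthogonal_of_sub_le {E : Type*} [AddCommGroup E] [Module ℂ E] {N : E → ℝ}
    (hN : ∀ A, 0 ≤ N A) {ε : ℝ} {A B : E}
    (h : ∀ z : ℂ, N A - ε * N (z • B) ≤ N (A + z • B)) : EpsBirkhoffOrthogonal N ε A B := by
  intro z
  rcases le_total (N A) (ε * N (z • B)) with hle | hle
  · nlinarith [mul_le_mul_of_nonneg_left hle (hN A), sq_nonneg (N (A + z • B)), hN A]
  · nlinarith [pow_le_pow_left₀ (sub_nonneg.2 hle) (h z) 2, sq_nonneg (ε * N (z • B))]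

theorem IsTopFrame.epsBirkhoffOrthogonal {E F : Type*}
    [NormedAddCommGroup E] [InnerProductSpace ℂ E] [FiniteDimensional ℂ E]
    [NormedAddCommGroup F] [InnerProductSpace ℂ F] [FiniteDimensional ℂ F]
    {T S : E →ₗ[ℂ] F} {p : ℝ} {k : ℕ} {v : Fin k → E} (hv : IsTopFrame T v) (hp : 2 ≤ p) {ε : ℝ}
    (hε : 0 ≤ ε)
    (h : ‖kyFanSupport p T v S‖ ≤ ε * operatorKyFanNorm p k T ^ (p - 1) * operatorKyFanNorm p k S) :
    EpsBirkhoffOrthogonal (operatorKyFanNorm p k) ε T S := by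
  refine epsBirkhoffOrthogonal_of_sub_le (operatorKyFanNorm_nonneg p k) fun z => ?_
  have smul_bound : operatorKyFanNorm p k (z • S) = ‖z‖ * operatorKyFanNorm p k S :=
    operatorKyFanNorm_smul hp hv.le_finrank z S
  rcases (operatorKyFanNorm_nonneg p k T).eq_or_lt with hT | hT
  · rw [← hT, zero_sub]
    exact (neg_nonpos.2 (mul_nonneg hε (operatorKyFanNorm_nonneg p k _))).trans
      (operatorKyFanNorm_nonneg p k _)
  refine le_of_mul_le_mul_left ?_ (Real.rpow_pos_of_pos hT (p - 1))
  calc operatorKyFanNorm p k T ^ (p - 1) *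
        (operatorKyFanNorm p k T - ε * operatorKyFanNorm p k (z • S))
      = operatorKyFanNorm p k T ^ p -
          ‖z‖ * (ε * operatorKyFanNorm p k T ^ (p - 1) * operatorKyFanNorm p k S) := by
        rw [smul_bound, mul_sub, ← Real.rpow_add_one hT.ne', sub_add_cancel]
        ring
    _ ≤ ‖kyFanSupport p T v T‖ - ‖z‖ * ‖kyFanSupport p T v S‖ := by
        rw [hv.kyFanSupport_self (by linarith), RCLike.norm_ofReal]
        gcongr
        exact le_abs_self _
    _ ≤ ‖kyFanSupport p T v (T + z • S)‖ := by
        rw [map_add, map_smul, smul_eq_mul, ← norm_mul]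
        exact norm_sub_le_norm_add _ _
    _ ≤ operatorKyFanNorm p k T ^ (p - 1) * operatorKyFanNorm p k (T + z • S) :=
        hv.norm_kyFanSupport_le hp _

section UnitIntervalWeights

theorem exists_ne_mem_Ioo_of_sum_eq_natCast {ι : Type*} [Fintype ι] {μ : ι → ℝ}
    (hμ : ∀ l, 0 ≤ μ l ∧ μ l ≤ 1) {r : ℕ} (hsum : ∑ l, μ l = r) {i : ι} (hi : μ i ∈ Set.Ioo 0 1) :
    ∃ j, j ≠ i ∧ μ j ∈ Set.Ioo 0 1 := by
  classical
  by_contra! h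
  have zero_or_one (l : ι) (hl : l ≠ i) : μ l = ((if μ l = 1 then 1 else 0 : ℕ) : ℝ) := by
    split_ifs with h1
    · simpa using h1
    · rw [Nat.cast_zero]
      by_contra h0
      exact h l hl ⟨(hμ l).1.lt_of_ne' h0, (hμ l).2.lt_of_ne h1⟩
  have hsum' : μ i + ((∑ l ∈ Finset.univ.erase i, if μ l = 1 then 1 else 0 : ℕ) : ℝ) = r := by
    rw [← hsum, ← Finset.add_sum_erase _ _ (Finset.mem_univ i), Nat.cast_sum]
    exact congrArg _ (Finset.sum_congr rfl fun l hl =>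
      (zero_or_one l (Finset.ne_of_mem_erase hl)).symm)
  set s : ℕ := ∑ l ∈ Finset.univ.erase i, if μ l = 1 then 1 else 0
  have h_lt : s < r := by exact_mod_cast (by linarith [hi.1] : (s : ℝ) < r)
  have h_gt : r < s + 1 := by exact_mod_cast (by linarith [hi.2] : (r : ℝ) < s + 1)
  omega

variable {κ ι M : Type*} [Fintype κ] [AddCommGroup M] [Module ℝ M] {μ : κ → ℝ}

open Classical in
theorem sum_smul_eq_sum_subtype (hμ : ∀ l, μ l = 0 ∨ μ l = 1) (f : κ → M) :
    ∑ l, μ l • f l = ∑ l : {l // μ l = 1}, f l := by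
  rw [← Finset.sum_subtype (Finset.univ.filter fun l => μ l = 1) (by simp) f, Finset.sum_filter]
  refine Finset.sum_congr rfl fun l _ => ?_
  rcases hμ l with h | h <;> simp [h]

theorem exists_injective_sum_smul_eq_sum [Fintype ι] (hμ : ∀ l, μ l = 0 ∨ μ l = 1)
    (hsum : ∑ l, μ l = Fintype.card ι) (f : κ → M) :
    ∃ e : ι → κ, Function.Injective e ∧ ∑ l, μ l • f l = ∑ i, f (e i) := by
  classical
  have hcard : Fintype.card ι = Fintype.card {l // μ l = 1} := by
    have := sum_smul_eq_sum_subtype hμ fun _ => (1 : ℝ)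
    simp only [smul_eq_mul, mul_one, hsum, Finset.sum_const, Finset.card_univ, nsmul_eq_mul] at this
    exact_mod_cast this
  let e : ι ≃ {l // μ l = 1} := Fintype.equivOfCardEq hcard
  refine ⟨fun i => e i, Subtype.val_injective.comp e.injective, ?_⟩
  rw [sum_smul_eq_sum_subtype hμ, ← e.sum_comp]

end UnitIntervalWeights

section NumericalRange

open Module InnerProductSpace

variable {E : Type*} [NormedAddCommGroup E] [InnerProductSpace ℂ E]

/-- The self-adjoint operators of trace zero on the span of an orthonormal pair `a, b`,
parametrized by their matrices `!![x, ζ; conj ζ, -x]`. -/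
noncomputable def pairPerturbation (a b : E) : ℝ × ℂ →ₗ[ℝ] (E →L[ℂ] E) where
  toFun c := c.1 • (rankOne ℂ a a - rankOne ℂ b b) +
    (rankOne ℂ (c.2 • a) b + rankOne ℂ b (c.2 • a))
  map_add' c d := by
    simp only [Prod.fst_add, Prod.snd_add, add_smul, map_add, add_apply]
    abel
  map_smul' r c := by
    simp only [Prod.smul_fst, Prod.smul_snd, smul_assoc, smul_add, map_smul,
      ← Complex.coe_smul r, map_smulₛₗ, smul_apply, RingHom.id_apply,
      Complex.conj_ofReal]

theorem pairPerturbation_apply (a b : E) (c : ℝ × ℂ) :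
    pairPerturbation a b c = c.1 • (rankOne ℂ a a - rankOne ℂ b b) +
      (rankOne ℂ (c.2 • a) b + rankOne ℂ b (c.2 • a)) :=
  rfl

theorem pairPerturbation_injective {a b : E} (ha : ‖a‖ = 1) (hb : b ≠ 0) (hab : inner ℂ a b = 0) :
    Function.Injective (pairPerturbation a b) := by
  refine (injective_iff_map_eq_zero _).2 fun c hc => ?_
  have hba : inner ℂ b a = 0 := inner_eq_zero_symm.1 hab
  have apply_a : (c.1 : ℂ) • a + inner ℂ (c.2 • a) a • b = 0 := by
    simpa [pairPerturbation_apply, ha, hba, inner_smul_left] using congr($hc a)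
  have haa : inner ℂ a a = 1 := inner_self_eq_one_of_norm_eq_one ha
  have hx : (c.1 : ℂ) = 0 := by
    simpa only [inner_add_right, inner_smul_right, haa, hab, mul_one, mul_zero, add_zero,
      inner_zero_right] using congr(inner ℂ a $apply_a)
  have hζ : c.2 = 0 := by
    rw [hx, zero_smul, zero_add, inner_smul_left, haa, mul_one, smul_eq_zero] at apply_a
    exact (map_eq_zero _).1 (apply_a.resolve_right hb)
  exact Prod.ext (by exact_mod_cast hx) hζ

theorem trace_pairPerturbation [FiniteDimensional ℂ E] {a b : E} (hnorm : ‖a‖ = ‖b‖)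
    (hab : inner ℂ a b = 0) (c : ℝ × ℂ) :
    LinearMap.trace ℂ E (pairPerturbation a b c : E →ₗ[ℂ] E) = 0 := by
  have hba : inner ℂ b a = 0 := inner_eq_zero_symm.1 hab
  simp [pairPerturbation_apply, ← Complex.coe_smul, trace_rankOne, hab, hba,
    inner_self_eq_norm_sq_to_K, hnorm]

theorem isPositive_pairPerturbation_add (a b : E) (c : ℝ × ℂ) :
    (pairPerturbation a b c +
      (|c.1| + ‖c.2‖ ^ 2 + 1) • (rankOne ℂ a a + rankOne ℂ b b)).IsPositive := by
  have hζ : rankOne ℂ (c.2 • a) (c.2 • a) = (‖c.2‖ ^ 2) • rankOne ℂ a a := by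
    ext x
    simp [smul_smul, Complex.mul_conj', ← Complex.coe_smul]
  have decomposition : pairPerturbation a b c +
      (|c.1| + ‖c.2‖ ^ 2 + 1) • (rankOne ℂ a a + rankOne ℂ b b) =
      ((|c.1| + c.1 + 1 : ℝ) : ℂ) • rankOne ℂ a a +
        ((|c.1| - c.1 + ‖c.2‖ ^ 2 : ℝ) : ℂ) • rankOne ℂ b b +
        rankOne ℂ (c.2 • a + b) (c.2 • a + b) := by
    simp only [pairPerturbation_apply, map_add, add_apply, hζ, Complex.coe_smul]
    module
  have ha : 0 ≤ |c.1| + c.1 + 1 := by linarith [neg_abs_le c.1]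
  have hb : 0 ≤ |c.1| - c.1 + ‖c.2‖ ^ 2 := by linarith [le_abs_self c.1, sq_nonneg ‖c.2‖]
  rw [decomposition]
  exact (((isPositive_rankOne_self a).smul_of_nonneg (by exact_mod_cast ha)).add
    ((isPositive_rankOne_self b).smul_of_nonneg (by exact_mod_cast hb))).add
    (isPositive_rankOne_self _)

theorem smul_rankOne_add_rankOne_le_sum [CompleteSpace E] {ι : Type*} [Fintype ι] {u : ι → E}
    {μ : ι → ℝ} (hμ : ∀ l, 0 ≤ μ l) {i j : ι} (hij : i ≠ j) {δ : ℝ} (hi : δ ≤ μ i)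
    (hj : δ ≤ μ j) :
    δ • (rankOne ℂ (u i) (u i) + rankOne ℂ (u j) (u j)) ≤ ∑ l, μ l • rankOne ℂ (u l) (u l) := by
  classical
  have rankOne_nonneg (l : ι) : 0 ≤ rankOne ℂ (u l) (u l) :=
    (ContinuousLinearMap.nonneg_iff_isPositive _).2 (isPositive_rankOne_self _)
  calc δ • (rankOne ℂ (u i) (u i) + rankOne ℂ (u j) (u j))
      ≤ ∑ l ∈ {i, j}, μ l • rankOne ℂ (u l) (u l) := by
        rw [Finset.sum_pair hij, smul_add]
        exact add_le_add (smul_le_smul_of_nonneg_right hi (rankOne_nonneg i))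
          (smul_le_smul_of_nonneg_right hj (rankOne_nonneg j))
    _ ≤ ∑ l, μ l • rankOne ℂ (u l) (u l) :=
        Finset.sum_le_univ_sum_of_nonneg fun l => smul_nonneg (hμ l) (rankOne_nonneg l)

theorem sum_smul_rankOne_add_smul_pairPerturbation_nonneg [CompleteSpace E] {ι : Type*} [Fintype ι]
    {u : ι → E} {μ : ι → ℝ} (hμ : ∀ l, 0 ≤ μ l) {i j : ι} (hij : i ≠ j) {c : ℝ × ℂ} {t : ℝ}
    (ht : 0 ≤ t) (hi : t * (|c.1| + ‖c.2‖ ^ 2 + 1) ≤ μ i)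
    (hj : t * (|c.1| + ‖c.2‖ ^ 2 + 1) ≤ μ j) :
    0 ≤ ∑ l, μ l • rankOne ℂ (u l) (u l) + t • pairPerturbation (u i) (u j) c := by
  calc (0 : E →L[ℂ] E)
      ≤ t • (pairPerturbation (u i) (u j) c +
          (|c.1| + ‖c.2‖ ^ 2 + 1) • (rankOne ℂ (u i) (u i) + rankOne ℂ (u j) (u j))) :=
        smul_nonneg ht ((ContinuousLinearMap.nonneg_iff_isPositive _).2
          (isPositive_pairPerturbation_add _ _ _))
    _ = (t * (|c.1| + ‖c.2‖ ^ 2 + 1)) • (rankOne ℂ (u i) (u i) + rankOne ℂ (u j) (u j)) +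
          t • pairPerturbation (u i) (u j) c := by
        rw [smul_add, smul_smul, add_comm]
    _ ≤ ∑ l, μ l • rankOne ℂ (u l) (u l) + t • pairPerturbation (u i) (u j) c :=
        add_le_add_left (smul_rankOne_add_rankOne_le_sum hμ hij hi hj) _

variable [FiniteDimensional ℂ E]

/-- The operators `0 ≤ X ≤ 1` of trace `r`, i.e. the convex hull of the orthogonal projections of
rank `r`. -/
def fractionalProjections (E : Type*) [NormedAddCommGroup E] [InnerProductSpace ℂ E] (r : ℕ) :
    Set (E →L[ℂ] E) :=
  {X | (0 ≤ X ∧ X ≤ 1) ∧ LinearMap.trace ℂ E (X : E →ₗ[ℂ] E) = r}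

theorem convex_fractionalProjections (r : ℕ) : Convex ℝ (fractionalProjections E r) := by
  have := FiniteDimensional.complete ℂ E
  refine (convex_Icc (0 : E →L[ℂ] E) 1).inter ?_
  exact (convex_singleton (r : ℂ)).linear_preimage
    ((LinearMap.trace ℂ E ∘ₗ ContinuousLinearMap.coeLM ℂ).restrictScalars ℝ)

theorem isCompact_fractionalProjections (r : ℕ) : IsCompact (fractionalProjections E r) := by
  have := FiniteDimensional.complete ℂ E
  have bounded : Bornology.IsBounded (Set.Icc (0 : E →L[ℂ] E) 1) :=
    Metric.isBounded_closedBall.subset fun X hX => mem_closedBall_zero_iff.2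
      ((CStarAlgebra.norm_le_one_iff_of_nonneg X hX.1).2 hX.2)
  refine (Metric.isCompact_of_isClosed_isBounded isClosed_Icc bounded).inter_right
    (isClosed_eq ?_ continuous_const)
  exact (LinearMap.trace ℂ E ∘ₗ ContinuousLinearMap.coeLM ℂ).continuous_of_finiteDimensional

theorem trace_sum_smul_rankOne {ι : Type*} [Fintype ι] {u : ι → E} (hu : ∀ l, ‖u l‖ = 1)
    (μ : ι → ℝ) :
    LinearMap.trace ℂ E ((∑ l, μ l • rankOne ℂ (u l) (u l) : E →L[ℂ] E) : E →ₗ[ℂ] E) =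
      ((∑ l, μ l : ℝ) : ℂ) := by
  simp [← Complex.coe_smul, trace_rankOne, inner_self_eq_norm_sq_to_K, hu]

theorem sum_rankOne_mem_fractionalProjections {ι : Type*} [Fintype ι] {w : ι → E}
    (hw : Orthonormal ℂ w) :
    ∑ l, rankOne ℂ (w l) (w l) ∈ fractionalProjections E (Fintype.card ι) := by
  have := FiniteDimensional.complete ℂ E
  refine ⟨⟨?_, ?_⟩, ?_⟩
  · exact Finset.sum_nonneg fun l _ =>
      (ContinuousLinearMap.nonneg_iff_isPositive _).2 (isPositive_rankOne_self _)
  · refine (ContinuousLinearMap.le_def _ _).2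
      ((ContinuousLinearMap.isPositive_iff_complex _).2 fun x => ?_)
    have defect : inner ℂ ((1 - ∑ l, rankOne ℂ (w l) (w l)) x) x =
        ((‖x‖ ^ 2 - ∑ l, ‖inner ℂ (w l) x‖ ^ 2 : ℝ) : ℂ) := by
      simp only [sub_apply, one_apply_eq_self, sum_apply, rankOne_apply, inner_sub_left, sum_inner,
        inner_smul_left, RCLike.conj_mul, inner_self_eq_norm_sq_to_K]
      norm_cast
    rw [defect]
    exact ⟨rfl, sub_nonneg.2 (hw.sum_inner_products_le (s := Finset.univ) x)⟩
  · simpa using trace_sum_smul_rankOne hw.1 1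

theorem exists_eq_sum_smul_rankOne {r : ℕ} {X : E →L[ℂ] E} (hX : X ∈ fractionalProjections E r) :
    ∃ (u : OrthonormalBasis (Fin (finrank ℂ E)) ℂ E) (μ : Fin (finrank ℂ E) → ℝ),
      (∀ l, 0 ≤ μ l ∧ μ l ≤ 1) ∧ ∑ l, μ l = r ∧ X = ∑ l, μ l • rankOne ℂ (u l) (u l) := by
  obtain ⟨⟨hX₀, hX₁⟩, htr⟩ := hX
  have hsymm : (X : E →ₗ[ℂ] E).IsSymmetric :=
    ((ContinuousLinearMap.nonneg_iff_isPositive X).1 hX₀).isSymmetric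
  let u := hsymm.eigenvectorBasis rfl
  let μ := hsymm.eigenvalues rfl
  have hXu (l) : X (u l) = μ l • u l := hsymm.apply_eigenvectorBasis rfl l
  have hsum : X = ∑ l, μ l • rankOne ℂ (u l) (u l) := by
    ext x
    conv_lhs => rw [← u.sum_repr' x]
    simp only [map_sum, map_smul, hXu, sum_apply, smul_apply, rankOne_apply]
    exact Finset.sum_congr rfl fun l _ => smul_comm _ _ _
  have hre (l) : μ l = RCLike.re (inner ℂ (X (u l)) (u l)) := by
    simp [hXu, ← Complex.coe_smul, inner_self_eq_norm_sq_to_K, u.orthonormal.1 l]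
  refine ⟨u, μ, fun l => ⟨?_, ?_⟩, ?_, hsum⟩
  · rw [hre]
    exact ((ContinuousLinearMap.nonneg_iff_isPositive X).1 hX₀).re_inner_nonneg_left _
  · have := ((ContinuousLinearMap.le_def _ _).1 hX₁).re_inner_nonneg_left (u l)
    rw [sub_apply, inner_sub_left, map_sub, ← hre] at this
    simpa [u.orthonormal.1 l] using this
  · rw [hsum, trace_sum_smul_rankOne u.orthonormal.1] at htr
    exact_mod_cast htr

theorem sum_smul_rankOne_add_smul_pairPerturbation_mem {r : ℕ} {ι : Type*} [Fintype ι]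
    (u : OrthonormalBasis ι ℂ E) {μ : ι → ℝ} (hμ : ∀ l, 0 ≤ μ l ∧ μ l ≤ 1) (hsum : ∑ l, μ l = r)
    {i j : ι} (hij : i ≠ j) {c : ℝ × ℂ} {t : ℝ} (ht : 0 ≤ t)
    (hi : t * (|c.1| + ‖c.2‖ ^ 2 + 1) ≤ min (μ i) (1 - μ i))
    (hj : t * (|c.1| + ‖c.2‖ ^ 2 + 1) ≤ min (μ j) (1 - μ j)) :
    ∑ l, μ l • rankOne ℂ (u l) (u l) + t • pairPerturbation (u i) (u j) c ∈
      fractionalProjections E r := by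
  have := FiniteDimensional.complete ℂ E
  obtain ⟨hi₀, hi₁⟩ := le_min_iff.1 hi
  obtain ⟨hj₀, hj₁⟩ := le_min_iff.1 hj
  have complement : 1 - (∑ l, μ l • rankOne ℂ (u l) (u l) + t • pairPerturbation (u i) (u j) c) =
      ∑ l, (1 - μ l) • rankOne ℂ (u l) (u l) + t • pairPerturbation (u i) (u j) (-c) := by
    simp only [sub_smul, one_smul, Finset.sum_sub_distrib, map_neg, smul_neg,
      u.sum_rankOne_eq_id, ← ContinuousLinearMap.one_def]
    abel
  refine ⟨⟨?_, sub_nonneg.1 ?_⟩, ?_⟩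
  · exact sum_smul_rankOne_add_smul_pairPerturbation_nonneg (fun l => (hμ l).1) hij ht hi₀ hj₀
  · rw [complement]
    exact sum_smul_rankOne_add_smul_pairPerturbation_nonneg (fun l => sub_nonneg.2 (hμ l).2) hij ht
      (by simpa using hi₁) (by simpa using hj₁)
  · have htr : LinearMap.trace ℂ E (pairPerturbation (u i) (u j) c : E →ₗ[ℂ] E) = 0 :=
      trace_pairPerturbation (by rw [u.norm_eq_one, u.norm_eq_one]) (u.orthonormal.2 hij) c
    rw [ContinuousLinearMap.toLinearMap_add, map_add, trace_sum_smul_rankOne u.norm_eq_one, hsum,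
      ← Complex.coe_smul, ContinuousLinearMap.toLinearMap_smul, map_smul, htr]
    simp

theorem exists_perturbation_mem_fractionalProjections {r : ℕ} {ι : Type*} [Fintype ι]
    (u : OrthonormalBasis ι ℂ E) {μ : ι → ℝ} (hμ : ∀ l, 0 ≤ μ l ∧ μ l ≤ 1) (hsum : ∑ l, μ l = r)
    {i : ι} (hi : μ i ∈ Set.Ioo 0 1) (L : (E →L[ℂ] E) →ₗ[ℝ] ℂ) :
    ∃ D : E →L[ℂ] E, D ≠ 0 ∧ L D = 0 ∧
      ∑ l, μ l • rankOne ℂ (u l) (u l) + D ∈ fractionalProjections E r ∧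
      ∑ l, μ l • rankOne ℂ (u l) (u l) - D ∈ fractionalProjections E r := by
  obtain ⟨j, hji, hj⟩ := exists_ne_mem_Ioo_of_sum_eq_natCast hμ hsum hi
  obtain ⟨c, hc_ker, hc⟩ := (Submodule.ne_bot_iff _).1 (LinearMap.ker_ne_bot_of_finrank_lt
    (f := L ∘ₗ pairPerturbation (u i) (u j)) (by simp))
  have hC : 0 < |c.1| + ‖c.2‖ ^ 2 + 1 := by positivity
  set δ : ℝ := min (min (μ i) (1 - μ i)) (min (μ j) (1 - μ j))
  have hδ_pos : 0 < δ :=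
    lt_min (lt_min hi.1 (sub_pos.2 hi.2)) (lt_min hj.1 (sub_pos.2 hj.2))
  set t : ℝ := δ / (|c.1| + ‖c.2‖ ^ 2 + 1)
  have ht : 0 < t := div_pos hδ_pos hC
  have htC : t * (|c.1| + ‖c.2‖ ^ 2 + 1) = δ := div_mul_cancel₀ δ hC.ne'
  refine ⟨t • pairPerturbation (u i) (u j) c, smul_ne_zero ht.ne' ?_, ?_, ?_, ?_⟩
  · exact (map_ne_zero_iff _ (pairPerturbation_injective (u.norm_eq_one i) (u.toBasis.ne_zero j)
      (u.orthonormal.2 hji.symm))).2 hc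
  · rw [map_smul, show L (pairPerturbation (u i) (u j) c) = 0 from hc_ker, smul_zero]
  · exact sum_smul_rankOne_add_smul_pairPerturbation_mem u hμ hsum hji.symm ht.le
      (htC.le.trans (min_le_left _ _)) (htC.le.trans (min_le_right _ _))
  · rw [sub_eq_add_neg, ← smul_neg, ← map_neg]
    refine sum_smul_rankOne_add_smul_pairPerturbation_mem u hμ hsum hji.symm ht.le ?_ ?_
    · simpa only [Prod.fst_neg, Prod.snd_neg, abs_neg, norm_neg, htC] using min_le_left _ _
    · simpa only [Prod.fst_neg, Prod.snd_neg, abs_neg, norm_neg, htC] using min_le_right _ _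

theorem exists_orthonormal_eq_sum_rankOne_of_mem_extremePoints {ι : Type*} [Fintype ι]
    {L : (E →L[ℂ] E) →ₗ[ℝ] ℂ} {z : ℂ} {X : E →L[ℂ] E}
    (hX : X ∈ Set.extremePoints ℝ (fractionalProjections E (Fintype.card ι) ∩ {Y | L Y = z})) :
    ∃ w : ι → E, Orthonormal ℂ w ∧ X = ∑ i, rankOne ℂ (w i) (w i) := by
  obtain ⟨⟨hX_mem, hXz : L X = z⟩, extreme⟩ := mem_extremePoints.1 hX
  obtain ⟨u, μ, hμ, hsum, hXμ⟩ := exists_eq_sum_smul_rankOne hX_mem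
  have zero_or_one (l) : μ l = 0 ∨ μ l = 1 := by
    by_contra! h
    obtain ⟨D, hD, hLD, hadd, hsub⟩ := exists_perturbation_mem_fractionalProjections u hμ hsum
      ⟨(hμ l).1.lt_of_ne' h.1, (hμ l).2.lt_of_ne h.2⟩ L
    rw [← hXμ] at hadd hsub
    have midpoint : X ∈ openSegment ℝ (X + D) (X - D) :=
      ⟨1 / 2, 1 / 2, by norm_num, by norm_num, by norm_num, by module⟩
    exact hD (add_eq_left.1 (extreme _ ⟨hadd, by simp [hLD, hXz]⟩ _ ⟨hsub, by simp [hLD, hXz]⟩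
      midpoint).1)
  obtain ⟨e, he, hsum_e⟩ := exists_injective_sum_smul_eq_sum zero_or_one hsum
    fun l => rankOne ℂ (u l) (u l)
  exact ⟨u ∘ e, u.orthonormal.comp e he, hXμ.trans hsum_e⟩

/-- Halmos' `k`-numerical range, `k` being the cardinality of `ι`: the partial traces of `A` over
the orthonormal families indexed by `ι`. -/
def kNumericalRange (ι : Type*) [Fintype ι] (A : E →L[ℂ] E) : Set ℂ :=
  {z | ∃ w : ι → E, Orthonormal ℂ w ∧ ∑ i, inner ℂ (w i) (A (w i)) = z}

/-- The functional `X ↦ tr (A X)`, as a real-linear map. -/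
noncomputable def traceMulLeft (A : E →L[ℂ] E) : (E →L[ℂ] E) →ₗ[ℝ] ℂ :=
  (LinearMap.trace ℂ E ∘ₗ ContinuousLinearMap.coeLM ℂ ∘ₗ LinearMap.mulLeft ℂ A).restrictScalars ℝ

theorem traceMulLeft_sum_rankOne {ι : Type*} [Fintype ι] (A : E →L[ℂ] E) (w : ι → E) :
    traceMulLeft A (∑ i, rankOne ℂ (w i) (w i)) = ∑ i, inner ℂ (w i) (A (w i)) := by
  have mul_rankOne (i : ι) : A * rankOne ℂ (w i) (w i) = rankOne ℂ (A (w i)) (w i) := by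
    ext x
    simp
  simp [traceMulLeft, mul_rankOne, trace_rankOne]

theorem kNumericalRange_eq_image (ι : Type*) [Fintype ι] (A : E →L[ℂ] E) :
    kNumericalRange ι A = traceMulLeft A '' fractionalProjections E (Fintype.card ι) := by
  have := FiniteDimensional.complete ℂ E
  ext z
  constructor
  · rintro ⟨w, hw, rfl⟩
    exact ⟨_, sum_rankOne_mem_fractionalProjections hw, traceMulLeft_sum_rankOne A w⟩
  · rintro ⟨Y, hY, hYz⟩
    have compact :
        IsCompact (fractionalProjections E (Fintype.card ι) ∩ {Y | traceMulLeft A Y = z}) :=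
      (isCompact_fractionalProjections _).inter_right
        (isClosed_eq (traceMulLeft A).continuous_of_finiteDimensional continuous_const)
    obtain ⟨X, hX⟩ := compact.extremePoints_nonempty ⟨Y, hY, hYz⟩
    obtain ⟨w, hw, rfl⟩ := exists_orthonormal_eq_sum_rankOne_of_mem_extremePoints hX
    exact ⟨w, hw, (traceMulLeft_sum_rankOne A w).symm.trans hX.1.2⟩

theorem convex_kNumericalRange (ι : Type*) [Fintype ι] (A : E →L[ℂ] E) :
    Convex ℝ (kNumericalRange ι A) := by
  rw [kNumericalRange_eq_image]
  exact (convex_fractionalProjections (E := E) (Fintype.card ι)).linear_image (traceMulLeft A)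

end NumericalRange

section SpectralRigidity

open Module

variable {𝕜 E F : Type*} [RCLike 𝕜] [NormedAddCommGroup E] [InnerProductSpace 𝕜 E]

theorem orthonormal_snoc {m : ℕ} {w : Fin m → E} (hw : Orthonormal 𝕜 w) {x : E} (hx : ‖x‖ = 1)
    (hwx : ∀ j, inner 𝕜 (w j) x = 0) :
    Orthonormal 𝕜 (Fin.snoc (α := fun _ => E) w x) := by
  have snoc_norm (i : Fin (m + 1)) : ‖(Fin.snoc w x : Fin (m + 1) → E) i‖ = 1 := by
    induction i using Fin.lastCases <;> simp [hx, hw.1]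
  refine ⟨snoc_norm, fun i j hij => ?_⟩
  induction i using Fin.lastCases with
  | last =>
    induction j using Fin.lastCases with
    | last => exact absurd rfl hij
    | cast j => simp [inner_eq_zero_symm.1 (hwx j)]
  | cast i =>
    induction j using Fin.lastCases with
    | last => simp [hwx i]
    | cast j => simpa using hw.2 (by simpa using hij)

namespace IsTopFrame

variable [FiniteDimensional 𝕜 E]
  [NormedAddCommGroup F] [InnerProductSpace 𝕜 F] [FiniteDimensional 𝕜 F]
  {T : E →ₗ[𝕜] F} {k : ℕ} {v v' : Fin k → E}

theorem norm_apply_le (hv : IsTopFrame T v) (i : Fin k) {x : E}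
    (hx : ∀ j < i, inner 𝕜 (v j) x = 0) :
    ‖T x‖ ≤ T.singularValues i * ‖x‖ := by
  rcases eq_or_ne x 0 with rfl | hx0
  · simp
  set y : E := ((‖x‖⁻¹ : ℝ) : 𝕜) • x with hy
  have hy_norm : ‖y‖ = 1 := by
    rw [hy, norm_smul, RCLike.norm_ofReal, abs_of_nonneg (by positivity),
      inv_mul_cancel₀ (norm_ne_zero_iff.2 hx0)]
  let w (j : Fin i) : E := v (j.castLE i.2.le)
  have hw : IsTopFrame T w := hv.comp_castLE i.2.le
  have hwy (j : Fin i) : inner 𝕜 (w j) y = 0 := by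
    rw [hy, inner_smul_right, hx _ (Fin.lt_def.2 j.2), mul_zero]
  have ky_fan := sum_norm_rpow_le_sum_singularValues_rpow T le_rfl
    (orthonormal_snoc hw.1 hy_norm hwy)
  simp only [Fin.sum_univ_castSucc, Fin.snoc_castSucc, Fin.snoc_last, hw.norm_apply,
    Finset.sum_range_succ, Real.rpow_two, add_le_add_iff_left,
    Fin.sum_univ_eq_sum_range (fun j => T.singularValues j ^ 2)] at ky_fan
  have hTy : ‖T y‖ = ‖x‖⁻¹ * ‖T x‖ := by
    rw [hy, map_smul, norm_smul, RCLike.norm_ofReal, abs_of_nonneg (by positivity)]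
  have := (sq_le_sq₀ (norm_nonneg _) (T.singularValues_nonneg i)).1 ky_fan
  rwa [hTy, inv_mul_le_iff₀ (norm_pos_iff.2 hx0), mul_comm] at this

theorem smul_inner_eq_of_apply_eq (hv : IsTopFrame T v) (i : Fin k) {x : E} {c : ℝ}
    (hx : LinearMap.adjoint T (T x) = ((c ^ 2 : ℝ) : 𝕜) • x) :
    ((T.singularValues i ^ 2 : ℝ) : 𝕜) * inner 𝕜 (v i) x = ((c ^ 2 : ℝ) : 𝕜) * inner 𝕜 (v i) x := by
  rw [← hv.inner_apply_apply, ← LinearMap.adjoint_inner_right, hx, inner_smul_right]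

theorem inner_eq_zero_of_ne (hv : IsTopFrame T v) (i : Fin k) {x : E} {c : ℝ} (hc : 0 ≤ c)
    (hx : LinearMap.adjoint T (T x) = ((c ^ 2 : ℝ) : 𝕜) • x) (hne : T.singularValues i ≠ c) :
    inner 𝕜 (v i) x = 0 := by
  refine (mul_eq_mul_right_iff.1 (hv.smul_inner_eq_of_apply_eq i hx)).resolve_left fun h => hne ?_
  exact (sq_eq_sq₀ (T.singularValues_nonneg i) hc).1 (by exact_mod_cast h)

theorem sum_inner_smul_eq_self (hv : IsTopFrame T v) (j : Fin k) {x : E} {c : ℝ}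
    (hx : LinearMap.adjoint T (T x) = ((c ^ 2 : ℝ) : 𝕜) • x) (hj : T.singularValues j < c) :
    ∑ i, inner 𝕜 (v i) x • v i = x := by
  set y := x - ∑ i, inner 𝕜 (v i) x • v i with hy
  have hy_orth (i : Fin k) : inner 𝕜 (v i) y = 0 := by
    rw [hy, inner_sub_right, hv.1.inner_right_fintype, sub_self]
  have hy_eigen : LinearMap.adjoint T (T y) = ((c ^ 2 : ℝ) : 𝕜) • y := by
    simp only [hy, map_sub, map_sum, map_smul, hx, hv.2, smul_sub, Finset.smul_sum, smul_smul]
    refine congrArg _ (Finset.sum_congr rfl fun i _ => ?_)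
    rw [mul_comm, hv.smul_inner_eq_of_apply_eq i hx]
  have hTy : ‖T y‖ ^ 2 = c ^ 2 * ‖y‖ ^ 2 := by
    have h : inner 𝕜 (T y) (T y) = ((c ^ 2 : ℝ) : 𝕜) * inner 𝕜 y y := by
      rw [← LinearMap.adjoint_inner_right, hy_eigen, inner_smul_right]
    rw [inner_self_eq_norm_sq_to_K, inner_self_eq_norm_sq_to_K] at h
    exact_mod_cast h
  have hy_zero : ‖y‖ = 0 := by
    have bound := hv.norm_apply_le j fun i _ => hy_orth i
    have := T.singularValues_nonneg j
    by_contra h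
    have : 0 < ‖y‖ := (norm_nonneg y).lt_of_ne' h
    have : ‖T y‖ < c * ‖y‖ := bound.trans_lt (by gcongr)
    nlinarith [norm_nonneg (T y)]
  exact (sub_eq_zero.1 (norm_eq_zero.1 hy_zero)).symm

theorem ofReal_mul_inner_congr (hv : IsTopFrame T v) (hv' : IsTopFrame T v') (g : ℝ → ℝ)
    (l i : Fin k) :
    ((g (T.singularValues l) : ℝ) : 𝕜) * inner 𝕜 (v l) (v' i) =
      ((g (T.singularValues i) : ℝ) : 𝕜) * inner 𝕜 (v l) (v' i) := by
  rcases eq_or_ne (T.singularValues l) (T.singularValues i) with h | h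
  · rw [h]
  · rw [hv.inner_eq_zero_of_ne l (T.singularValues_nonneg i) (hv'.2 i) h, mul_zero, mul_zero]

theorem ofReal_smul_eq_sum (hv : IsTopFrame T v) (hv' : IsTopFrame T v') {j : Fin k} {g : ℝ → ℝ}
    (hg : ∀ s ≤ T.singularValues j, g s = 0) (i : Fin k) :
    ((g (T.singularValues i) : ℝ) : 𝕜) • v' i =
      ∑ l : Fin k, (((g (T.singularValues l) : ℝ) : 𝕜) * inner 𝕜 (v l) (v' i)) • v l := by
  simp only [hv.ofReal_mul_inner_congr hv', mul_smul, ← Finset.smul_sum]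
  rcases le_or_gt (T.singularValues i) (T.singularValues j) with h | h
  · simp only [hg _ h, RCLike.ofReal_zero, zero_smul]
  · rw [hv.sum_inner_smul_eq_self j (hv'.2 i) h]

theorem sum_mul_inner_apply_eq (hv : IsTopFrame T v) (hv' : IsTopFrame T v') {j : Fin k}
    {g : ℝ → ℝ} (hg : ∀ s ≤ T.singularValues j, g s = 0) (A : E →ₗ[𝕜] E) :
    ∑ i : Fin k, ((g (T.singularValues i) : ℝ) : 𝕜) * inner 𝕜 (v i) (A (v i)) =
      ∑ i : Fin k, ((g (T.singularValues i) : ℝ) : 𝕜) * inner 𝕜 (v' i) (A (v' i)) := by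
  calc ∑ l : Fin k, ((g (T.singularValues l) : ℝ) : 𝕜) * inner 𝕜 (v l) (A (v l))
      = ∑ l : Fin k, ∑ i : Fin k, ((g (T.singularValues i) : ℝ) : 𝕜) * inner 𝕜 (v l) (v' i) *
          inner 𝕜 (v' i) (A (v l)) := by
        refine Finset.sum_congr rfl fun l _ => ?_
        rw [← RCLike.conj_ofReal, ← inner_smul_left, hv'.ofReal_smul_eq_sum hv hg, sum_inner]
        simp only [inner_smul_left, map_mul, RCLike.conj_ofReal, inner_conj_symm]
    _ = ∑ i : Fin k, ∑ l : Fin k, ((g (T.singularValues l) : ℝ) : 𝕜) * inner 𝕜 (v l) (v' i) *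
          inner 𝕜 (v' i) (A (v l)) := by
        rw [Finset.sum_comm]
        simp only [hv.ofReal_mul_inner_congr hv' g]
    _ = ∑ i : Fin k, ((g (T.singularValues i) : ℝ) : 𝕜) * inner 𝕜 (v' i) (A (v' i)) := by
        refine Finset.sum_congr rfl fun i _ => ?_
        rw [← inner_smul_right, ← map_smul, hv.ofReal_smul_eq_sum hv' hg, map_sum, inner_sum]
        simp only [map_smul, inner_smul_right]

theorem replace_eigenvectors (hv : IsTopFrame T v) {τ : ℝ} (hτ : 0 ≤ τ)
    {w : {i : Fin k // T.singularValues i = τ} → E} (hw : Orthonormal 𝕜 w)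
    (hw_eigen : ∀ i, LinearMap.adjoint T (T (w i)) = ((τ ^ 2 : ℝ) : 𝕜) • w i) :
    IsTopFrame T fun i => if h : T.singularValues i = τ then w ⟨i, h⟩ else v i := by
  refine ⟨⟨fun i => ?_, fun i j hij => ?_⟩, fun i => ?_⟩
  · dsimp only
    split_ifs
    exacts [hw.1 _, hv.1.1 i]
  · dsimp only
    split_ifs with hi hj hj
    · exact hw.2 (by simpa using hij)
    · exact inner_eq_zero_symm.1 (hv.inner_eq_zero_of_ne j hτ (hw_eigen _) hj)
    · exact hv.inner_eq_zero_of_ne i hτ (hw_eigen _) hi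
    · exact hv.1.2 hij
  · dsimp only
    split_ifs with hi
    · rw [hw_eigen, hi]
    · exact hv.2 i

/-- The first sum involves only a reference frame `v'`, so the dependence on `v` is confined to the
members of `v` belonging to the smallest of the `k` singular values. -/
theorem kyFanSupport_eq_add (hv : IsTopFrame T v) (hv' : IsTopFrame T v') (p : ℝ) {j : Fin k}
    (hj : ∀ i : Fin k, T.singularValues j ≤ T.singularValues i) (S : E →ₗ[𝕜] F) :
    kyFanSupport p T v S =
      ∑ i : Fin k, ((if T.singularValues i ≤ T.singularValues j then 0
          else T.singularValues i ^ (p - 2) : ℝ) : 𝕜) * inner 𝕜 (T (v' i)) (S (v' i)) +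
        ((T.singularValues j ^ (p - 2) : ℝ) : 𝕜) *
          ∑ i : {i : Fin k // T.singularValues i = T.singularValues j},
            inner 𝕜 (v i) (LinearMap.adjoint T (S (v i))) := by
  have lowest : ∑ i : {i : Fin k // T.singularValues i = T.singularValues j},
        inner 𝕜 (v i) (LinearMap.adjoint T (S (v i))) =
      ∑ i : Fin k, if T.singularValues i = T.singularValues j then inner 𝕜 (T (v i)) (S (v i))
        else 0 := by
    simp only [LinearMap.adjoint_inner_right]
    rw [← Finset.sum_filter]
    exact (Finset.sum_subtype _ (by simp) fun i => inner 𝕜 (T (v i)) (S (v i))).symm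
  have rigid := hv.sum_mul_inner_apply_eq hv' (j := j)
    (g := fun s => if s ≤ T.singularValues j then 0 else s ^ (p - 2)) (fun s hs => if_pos hs)
    (LinearMap.adjoint T ∘ₗ S)
  simp only [LinearMap.comp_apply, LinearMap.adjoint_inner_right] at rigid
  rw [← rigid, lowest, Finset.mul_sum, ← Finset.sum_add_distrib, kyFanSupport_apply]
  refine Finset.sum_congr rfl fun i _ => ?_
  rcases (hj i).eq_or_lt with h | h
  · simp [h]
  · simp [h.ne', h.not_ge]

end IsTopFrame

end SpectralRigidity

section SupportSet

open Module InnerProductSpace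

variable {E F : Type*} [NormedAddCommGroup E] [InnerProductSpace ℂ E] [FiniteDimensional ℂ E]
  [NormedAddCommGroup F] [InnerProductSpace ℂ F] [FiniteDimensional ℂ F] {k : ℕ}

theorem convex_setOf_sum_inner_mem (ι : Type*) [Fintype ι] (A : E →ₗ[ℂ] E) (G : Submodule ℂ E) :
    Convex ℝ {z : ℂ | ∃ w : ι → E, Orthonormal ℂ w ∧ (∀ i, w i ∈ G) ∧
      ∑ i, inner ℂ (w i) (A (w i)) = z} := by
  let compression : G →L[ℂ] G :=
    G.orthogonalProjectionOnto ∘L A.toContinuousLinearMap ∘L G.subtypeL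
  have inner_compression (x : G) : inner ℂ x (compression x) = inner ℂ (x : E) (A x) := by
    simp [compression]
  convert convex_kNumericalRange ι compression using 1
  ext z
  constructor
  · rintro ⟨w, hw, hwG, rfl⟩
    refine ⟨fun i => ⟨w i, hwG i⟩, ?_, by simp only [inner_compression]⟩
    exact (G.subtypeₗᵢ.orthonormal_comp_iff).1 hw
  · rintro ⟨w, hw, rfl⟩
    refine ⟨fun i => w i, hw.comp_linearIsometry G.subtypeₗᵢ, fun i => (w i).2, ?_⟩
    simp only [inner_compression]

theorem convex_setOf_sum_inner_isTopFrame (A : E →ₗ[ℂ] E) (T : E →ₗ[ℂ] F) {τ : ℝ} (hτ : 0 ≤ τ) :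
    Convex ℝ {z : ℂ | ∃ v : Fin k → E, IsTopFrame T v ∧
      ∑ i : {i : Fin k // T.singularValues i = τ}, inner ℂ (v i) (A (v i)) = z} := by
  by_cases hne : ∃ v : Fin k → E, IsTopFrame T v
  swap
  · simp only [not_exists] at hne
    simp [hne, convex_empty]
  obtain ⟨v₀, hv₀⟩ := hne
  convert convex_setOf_sum_inner_mem {i : Fin k // T.singularValues i = τ} A
    (End.eigenspace (LinearMap.adjoint T ∘ₗ T) ((τ ^ 2 : ℝ) : ℂ)) using 1
  ext z
  constructor
  · rintro ⟨v, hv, rfl⟩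
    refine ⟨fun i => v i, hv.1.comp _ Subtype.val_injective, fun i => ?_, rfl⟩
    have eigen := hv.2 i
    rw [i.2] at eigen
    exact End.mem_eigenspace_iff.2 eigen
  · rintro ⟨w, hw, hw_eigen, rfl⟩
    refine ⟨_, hv₀.replace_eigenvectors hτ hw fun i => End.mem_eigenspace_iff.1 (hw_eigen i), ?_⟩
    refine Finset.sum_congr rfl fun i _ => ?_
    simp only [i.2, dif_pos]

theorem convex_setOf_kyFanSupport (p : ℝ) (T S : E →ₗ[ℂ] F) :
    Convex ℝ {z : ℂ | ∃ v : Fin k → E, IsTopFrame T v ∧ kyFanSupport p T v S = z} := by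
  rcases k with _ | m
  · refine Set.Subsingleton.convex ?_
    rintro _ ⟨v, _, rfl⟩ _ ⟨v', _, rfl⟩
    rw [Subsingleton.elim v v']
  rintro _ ⟨v, hv, rfl⟩ _ ⟨v', hv', rfl⟩ a b ha hb hab
  have hlast (i : Fin (m + 1)) : T.singularValues (Fin.last m) ≤ T.singularValues i :=
    T.singularValues_antitone (Fin.le_last i)
  obtain ⟨u, hu, huz⟩ := convex_setOf_sum_inner_isTopFrame (LinearMap.adjoint T ∘ₗ S) T
    (T.singularValues_nonneg (Fin.last m)) ⟨v, hv, rfl⟩ ⟨v', hv', rfl⟩ ha hb hab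
  simp only [LinearMap.comp_apply] at huz
  refine ⟨u, hu, ?_⟩
  rw [hu.kyFanSupport_eq_add hv p hlast, hv'.kyFanSupport_eq_add hv p hlast,
    hv.kyFanSupport_eq_add hv p hlast, huz, smul_add, smul_add, add_add_add_comm, ← add_smul, hab,
    one_smul, mul_add, mul_smul_comm, mul_smul_comm]

theorem isCompact_setOf_kyFanSupport {p : ℝ} (hp : 2 ≤ p) (T S : E →ₗ[ℂ] F) :
    IsCompact {z : ℂ | ∃ v : Fin k → E, IsTopFrame T v ∧ kyFanSupport p T v S = z} := by
  have at_T : Continuous fun v : Fin k → E => (T.toContinuousLinearMap, v) := by fun_prop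
  have compact : IsCompact {v : Fin k → E | IsTopFrame T v} :=
    (isCompact_setOf_orthonormal (𝕜 := ℂ) (Fin k)).of_isClosed_subset
      (isClosed_setOf_isTopFrame.preimage at_T) fun v hv => hv.1
  have cont : Continuous fun v : Fin k → E => kyFanSupport p T v S := by
    simpa [Function.comp_def] using (continuous_kyFanSupport hp S).comp at_T
  exact compact.image cont

end SupportSet

section Characterization

open Module

theorem exists_norm_le_of_forall_exists_inner_le {H : Type*} [NormedAddCommGroup H]
    [InnerProductSpace ℝ H] {K : Set H} (hK : IsComplete K) (hK_conv : Convex ℝ K) {r : ℝ}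
    (hr : 0 ≤ r) (h : ∀ u : H, ∃ c ∈ K, inner ℝ u c ≤ r * ‖u‖) : ∃ c ∈ K, ‖c‖ ≤ r := by
  obtain ⟨c₀, hc₀, -⟩ := h 0
  obtain ⟨c, hc, hc_min⟩ := exists_norm_eq_iInf_of_complete_convex ⟨c₀, hc₀⟩ hK hK_conv 0
  obtain ⟨w, hw, hcw⟩ := h c
  have obtuse := (norm_eq_iInf_iff_real_inner_le_zero hK_conv hc).1 hc_min w hw
  rw [zero_sub, inner_neg_left, inner_sub_right, real_inner_self_eq_norm_sq] at obtuse
  refine ⟨c, hc, ?_⟩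
  by_contra! hlt
  nlinarith

theorem exists_add_mul_ofReal_eq_zero_iff {𝕜 : Type*} [RCLike 𝕜] {d : 𝕜} {r : ℝ} (hr : 0 ≤ r) :
    (∃ z : 𝕜, ‖z‖ ≤ 1 ∧ d + z * (r : 𝕜) = 0) ↔ ‖d‖ ≤ r := by
  constructor
  · rintro ⟨z, hz, h⟩
    rw [eq_neg_of_add_eq_zero_left h, norm_neg, norm_mul, RCLike.norm_ofReal, abs_of_nonneg hr]
    exact mul_le_of_le_one_left hr hz
  · intro h
    refine ⟨-d / r, ?_, ?_⟩
    · rw [norm_div, norm_neg, RCLike.norm_ofReal, abs_of_nonneg hr]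
      exact div_le_one_of_le₀ h hr
    · rcases eq_or_ne r 0 with rfl | hr0
      · simpa using h
      · rw [div_mul_cancel₀ _ (RCLike.ofReal_ne_zero.2 hr0), add_neg_cancel]

variable {E F : Type*} [NormedAddCommGroup E] [InnerProductSpace ℂ E] [FiniteDimensional ℂ E]
  [NormedAddCommGroup F] [InnerProductSpace ℂ F] [FiniteDimensional ℂ F] {p ε : ℝ} {k : ℕ}
  {T S : E →ₗ[ℂ] F}

theorem EpsBirkhoffOrthogonal.exists_norm_kyFanSupport_le
    (h : EpsBirkhoffOrthogonal (operatorKyFanNorm p k) ε T S) (hp : 2 ≤ p)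
    (hk : k ≤ finrank ℂ E) (hε : 0 ≤ ε) :
    ∃ v : Fin k → E, IsTopFrame T v ∧
      ‖kyFanSupport p T v S‖ ≤ ε * operatorKyFanNorm p k T ^ (p - 1) * operatorKyFanNorm p k S := by
  have radius_nonneg :
      0 ≤ ε * operatorKyFanNorm p k T ^ (p - 1) * operatorKyFanNorm p k S :=
    mul_nonneg (mul_nonneg hε (Real.rpow_nonneg (operatorKyFanNorm_nonneg p k T) _))
      (operatorKyFanNorm_nonneg p k S)
  obtain ⟨_, ⟨v, hv, rfl⟩, hle⟩ := exists_norm_le_of_forall_exists_inner_le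
    (isCompact_setOf_kyFanSupport (k := k) hp T S).isComplete (convex_setOf_kyFanSupport p T S)
    radius_nonneg fun u => by
      have norm_dir (c : ℂ) (R : E →ₗ[ℂ] F) :
          operatorKyFanNorm p k (c • R) = ‖c‖ * operatorKyFanNorm p k R :=
        operatorKyFanNorm_smul hp hk c R
      obtain ⟨v, hv, hre⟩ := exists_isTopFrame_re_kyFanSupport_ge (ε := ε) hp hk T
        (-(starRingEnd ℂ) u • S) fun t ht => by
          have := h ((t : ℂ) * -(starRingEnd ℂ) u)
          rwa [mul_smul, norm_dir, Complex.norm_real, Real.norm_of_nonneg ht.le] at this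
      refine ⟨_, ⟨v, hv, rfl⟩, ?_⟩
      rw [map_smul, norm_dir, norm_neg, RCLike.norm_conj] at hre
      simp only [smul_eq_mul, neg_mul, map_neg] at hre
      rw [Complex.inner, mul_comm (kyFanSupport p T v S)]
      exact (neg_le_neg_iff.1 hre).trans_eq (by ring)
  exact ⟨v, hv, hle⟩

theorem IsTopFrame.norm_normalized_kyFanSupport_le_iff {v : Fin k → E} (hv : IsTopFrame T v)
    (hp : 2 ≤ p) (hε : 0 ≤ ε) :
    ‖((1 / operatorKyFanNorm p k T ^ (p - 1) : ℝ) : ℂ) * kyFanSupport p T v S‖ ≤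
        ε * operatorKyFanNorm p k S ↔
      ‖kyFanSupport p T v S‖ ≤ ε * operatorKyFanNorm p k T ^ (p - 1) * operatorKyFanNorm p k S := by
  rw [norm_mul, Complex.norm_real, one_div, norm_inv, Real.norm_of_nonneg
    (Real.rpow_nonneg (operatorKyFanNorm_nonneg p k T) _)]
  rcases (operatorKyFanNorm_nonneg p k T).eq_or_lt with hT | hT
  · have := hv.norm_kyFanSupport_le hp S
    rw [← hT, Real.zero_rpow (by linarith)] at this ⊢
    simpa [mul_nonneg hε (operatorKyFanNorm_nonneg p k S)] using this
  · rw [inv_mul_le_iff₀ (Real.rpow_pos_of_pos hT _), ← mul_assoc, mul_comm ε]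

theorem mainTheorem7_general (hk : k ≤ finrank ℂ E) (hp : 2 ≤ p) (hε : 0 ≤ ε) :
    EpsBirkhoffOrthogonal (operatorKyFanNorm p k) ε T S ↔
      ∃ v : Fin k → E, IsTopFrame T v ∧ ∃ z₀ : ℂ, ‖z₀‖ ≤ 1 ∧
        ((1 / operatorKyFanNorm p k T ^ (p - 1) : ℝ) : ℂ) * kyFanSupport p T v S +
          z₀ * (ε : ℂ) * (operatorKyFanNorm p k S : ℂ) = 0 := by
  simp only [mul_assoc _ (ε : ℂ), ← Complex.ofReal_mul ε]
  have radius_nonneg := mul_nonneg hε (operatorKyFanNorm_nonneg p k S)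
  constructor
  · intro h
    obtain ⟨v, hv, hle⟩ := h.exists_norm_kyFanSupport_le hp hk hε
    exact ⟨v, hv, (exists_add_mul_ofReal_eq_zero_iff radius_nonneg).2
      ((hv.norm_normalized_kyFanSupport_le_iff hp hε).2 hle)⟩
  · rintro ⟨v, hv, hz⟩
    exact hv.epsBirkhoffOrthogonal hp hε ((hv.norm_normalized_kyFanSupport_le_iff hp hε).1
      ((exists_add_mul_ofReal_eq_zero_iff radius_nonneg).1 hz))

end Characterization

section Matrices

open Matrix Polynomial

variable {m n k : ℕ}

theorem toEuclideanLin_aeval_apply {ι 𝕜 : Type*} [Fintype ι] [DecidableEq ι] [RCLike 𝕜]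
    {H : Matrix ι ι 𝕜} {x : EuclideanSpace 𝕜 ι} {a : ℝ} (hx : toEuclideanLin H x = (a : 𝕜) • x)
    (q : ℝ[X]) : toEuclideanLin (aeval H q) x = ((q.eval a : ℝ) : 𝕜) • x := by
  have h := Module.End.aeval_apply_of_mem_apply_eq_smul (p := q.map (algebraMap ℝ 𝕜)) hx
  rw [eval_map_algebraMap, ← RCLike.algebraMap_eq_ofReal, aeval_algebraMap_apply_eq_algebraMap_eval]
    at h
  rw [← aeval_map_algebraMap 𝕜, ← RCLike.algebraMap_eq_ofReal, ← h]
  exact LinearMap.congr_fun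
    (aeval_algHom_apply (toLpLinAlgEquiv (R := 𝕜) 2) H (q.map (algebraMap ℝ 𝕜))).symm x

theorem toEuclideanLin_cfc_apply {ι 𝕜 : Type*} [Fintype ι] [DecidableEq ι] [RCLike 𝕜]
    {H : Matrix ι ι 𝕜} (hH : H.IsHermitian) {x : EuclideanSpace 𝕜 ι} {a : ℝ}
    (hx : toEuclideanLin H x = (a : 𝕜) • x) (f : ℝ → ℝ) :
    toEuclideanLin (cfc f H) x = ((f a : ℝ) : 𝕜) • x := by
  have finite_spectrum : (spectrum ℝ H).Finite := Matrix.finite_real_spectrum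
  let nodes : Finset ℝ := insert a finite_spectrum.toFinset
  let q := Lagrange.interpolate nodes id f
  have hq (y : ℝ) (hy : y ∈ nodes) : q.eval y = f y :=
    Lagrange.eval_interpolate_at_node f Function.injective_id.injOn hy
  have cfc_eq_aeval : cfc f H = aeval H q := by
    rw [← cfc_polynomial q H hH]
    exact cfc_congr fun y hy =>
      (hq y (Finset.mem_insert_of_mem (finite_spectrum.mem_toFinset.2 hy))).symm
  rw [cfc_eq_aeval, toEuclideanLin_aeval_apply hx, hq a (Finset.mem_insert_self _ _)]

theorem isTopFrame_toEuclideanLin_iff {A : Matrix (Fin m) (Fin n) ℂ}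
    {v : Fin k → EuclideanSpace ℂ (Fin n)} :
    IsTopFrame (toEuclideanLin A) v ↔ Orthonormal ℂ v ∧
      ∀ i : Fin k, toEuclideanLin (A.conjTranspose * A) (v i) =
        ((singularValue A i ^ 2 : ℝ) : ℂ) • v i := by
  rw [toEuclideanLin, toLpLin_mul 2 2 2, ← toEuclideanLin, ← toEuclideanLin,
    toEuclideanLin_conjTranspose_eq_adjoint]
  rfl

theorem IsTopFrame.sum_inner_gramPow_apply {A : Matrix (Fin m) (Fin n) ℂ}
    {v : Fin k → EuclideanSpace ℂ (Fin n)} (hv : IsTopFrame (toEuclideanLin A) v) (p : ℝ)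
    (B : Matrix (Fin m) (Fin n) ℂ) :
    ∑ i : Fin k, inner ℂ (v i)
        (toEuclideanLin (gramPow A ((p - 2) / 2) * A.conjTranspose * B) (v i)) =
      kyFanSupport p (toEuclideanLin A) v (toEuclideanLin B) := by
  have gramPow_hermitian : (gramPow A ((p - 2) / 2)).IsHermitian :=
    cfc_predicate (fun x : ℝ => x ^ ((p - 2) / 2)) (A.conjTranspose * A)
  refine Finset.sum_congr rfl fun i _ => ?_
  have gramPow_apply : toEuclideanLin (gramPow A ((p - 2) / 2)) (v i) =
      (((toEuclideanLin A).singularValues i ^ (p - 2) : ℝ) : ℂ) • v i := by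
    rw [← sq_rpow_div_two (LinearMap.singularValues_nonneg _ _)]
    exact toEuclideanLin_cfc_apply (isHermitian_conjTranspose_mul_self A)
      ((isTopFrame_toEuclideanLin_iff.1 hv).2 i) fun x : ℝ => x ^ ((p - 2) / 2)
  have factor : toEuclideanLin (gramPow A ((p - 2) / 2) * A.conjTranspose * B) =
      toEuclideanLin (gramPow A ((p - 2) / 2)) ∘ₗ LinearMap.adjoint (toEuclideanLin A) ∘ₗ
        toEuclideanLin B := by
    rw [Matrix.mul_assoc, ← toEuclideanLin_conjTranspose_eq_adjoint]
    simp only [toEuclideanLin, toLpLin_mul 2 2 2]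
  rw [factor, LinearMap.comp_apply, LinearMap.comp_apply,
    ← (isSymmetric_toEuclideanLin_iff.2 gramPow_hermitian) (v i), gramPow_apply,
    inner_smul_left, Complex.conj_ofReal, LinearMap.adjoint_inner_right]
  rfl

theorem epsBirkhoffOrthogonal_kyFanNorm_iff {A B : Matrix (Fin m) (Fin n) ℂ} {p ε : ℝ} :
    EpsBirkhoffOrthogonal (kyFanNorm p k) ε A B ↔
      EpsBirkhoffOrthogonal (operatorKyFanNorm p k) ε (toEuclideanLin A) (toEuclideanLin B) := by
  refine forall_congr' fun z => ?_
  rw [← map_smul, ← map_add]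
  rfl

end Matrices

theorem mainTheorem7 {m n k : ℕ} (hk : 1 ≤ k) (hkm : k ≤ m) (hkn : k ≤ n)
    (A B : Matrix (Fin m) (Fin n) ℂ) (p : ℝ) (hp : 2 ≤ p)
    (ε : ℝ) (hε0 : 0 ≤ ε) (hε1 : ε < 1) :
    EpsBirkhoffOrthogonal (kyFanNorm p k) ε A B ↔
      ∃ v : Fin k → EuclideanSpace ℂ (Fin n), Orthonormal ℂ v ∧
        (∀ i : Fin k, Matrix.toEuclideanLin (A.conjTranspose * A) (v i) =
          ((singularValue A i ^ 2 : ℝ) : ℂ) • v i) ∧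
        ∃ z₀ : ℂ, ‖z₀‖ ≤ 1 ∧
          ((1 / kyFanNorm p k A ^ (p - 1) : ℝ) : ℂ) *
              ∑ i : Fin k, inner ℂ (v i)
                (Matrix.toEuclideanLin (gramPow A ((p - 2) / 2) * A.conjTranspose * B) (v i)) +
            z₀ * (ε : ℂ) * (kyFanNorm p k B : ℂ) = 0 := by
  rw [epsBirkhoffOrthogonal_kyFanNorm_iff, mainTheorem7_general (by simpa using hkn) hp hε0]
  refine exists_congr fun v => ?_
  rw [← and_assoc, ← isTopFrame_toEuclideanLin_iff]
  refine and_congr_right fun hv => ?_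
  rw [hv.sum_inner_gramPow_apply]
  rfl
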